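/- Throughout, all systems $A,B,\dots$ are finite-dimensional of dimension $d\ge 1$, $\pi=\mathbb 1/d$ is the maximally mixed state, logarithms are in base $2$, and $\inf\emptyset=+\infty$. Write $\mathcal R^{\pi}_{A}(\cdot)=\operatorname{tr}_A[\cdot]\otimes\pi_A$ for the replacement channel (acting as the identity on other systems), and $\mathrm{CPTP}(A_0B_0,A_1B_1)$ for the set of completely positive trace-preserving maps (channels) $A_0B_0\to A_1B_1$. **Definitions.** A channel $\mathcal E\in\mathrm{CPTP}(A_0B_0,A_1B_1)$ is *non-signalling* ($\mathcal E\in\mathrm{NS}$) if $\mathcal R^\pi_{A_1}\circ\mathcal E=\mathcal R^\pi_{A_1}\circ\mathcal E\circ\mathcal R^\pi_{A_0}$ and $\mathcal R^\pi_{B_1}\circ\mathcal E=\mathcal R^\pi_{B_1}\circ\mathcal E\circ\mathcal R^\pi_{B_0}$. A *superchannel* is a linear map $\Theta$ from linear maps to linear maps such that $\mathbb I_R\otimes\Theta$ sends channels to channels for all reference systems $R_0,R_1$ (where $\mathbb I_R$ is the identity on maps $R_0\to R_1$). A superchannel $\Theta_{(\bar A_0\bar B_0\to\bar A_1\bar B_1)\to(A_0B_0\to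 A_1B_1)}$ is a *non-signalling bipartite superchannel* if $$\mathcal R^{\pi}_{A_0A_1}\circ\Theta\circ\mathcal R^{\pi}_{\bar A_0}=\mathcal R^{\pi}_{A_1}\circ\Theta\circ\mathcal R^{\pi}_{\bar A_0},\qquad \mathcal R^{\pi}_{A_1}\circ\Theta\circ\mathcal R^{\pi}_{\bar A_1}=\mathcal R^{\pi}_{A_1}\circ\Theta,$$ and the same two equations hold with $B$ in place of $A$; here a replacement channel acts as a supermap by composition, at the input for subscript $0$ and at the output for subscript $1$, and $\mathcal R^\pi_{A_0A_1}(\mathcal M)=\mathcal R^\pi_{A_1}\circ\mathcal M\circ\mathcal R^\pi_{A_0}$. For channels $\mathcal N,\mathcal E$ from $A$ to $B$, let $D_{\max}(\mathcal N\|\mathcal E)=\sup_{\psi_{RA}}D_{\max}(\mathcal N(\psi_{RA})\|\mathcal E(\psi_{RA}))$ over pure states $\psi_{RA}$ with $R\cong A$, where $D_{\max}(\rho\|\sigma)=\log\min\{t:\rho\le t\sigma\}$. For $\mathcal N\in\mathrm{CPTP}(A_0B_0,A_1B_1)$ and $\epsilon\ge0$ let $$\mathfrak D_{\max}^{\leftrightarrow}(\mathcal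 N)=\inf_{\mathcal E\in\mathrm{NS}}D_{\max}(\mathcal N\|\mathcal E),\qquad \mathfrak D_{\max}^{\leftrightarrow,\epsilon}(\mathcal N)=\inf\Big\{\mathfrak D_{\max}^{\leftrightarrow}(\mathcal M): \mathcal M\in\mathrm{CPTP}(A_0B_0,A_1B_1),\ \tfrac12\|\mathcal M-\mathcal N\|_\diamond\le\epsilon\Big\},$$ with $\|\mathcal F\|_\diamond=\sup_{k}\sup_{\|X\|_1\le1}\|(\mathcal F\otimes\mathrm{id}_k)(X)\|_1$. For $m\ge1$ let $\Upsilon_m$ be the noiseless bidirectional classical channel $\Upsilon_m(X)=\sum_{k,l=0}^{m-1}\langle kl|X|kl\rangle\,|lk\rangle\langle lk|$, with input on $\bar A_0\bar B_0$, output on $\bar A_1\bar B_1$, and all four systems of dimension $m$. The minimum simulation error is $e_{\mathrm{NS}}(\Upsilon_m,\mathcal N)=\frac12\inf_\Theta\|\Theta(\Upsilon_m)-\mathcal N\|_\diamond$ over all non-signalling bipartite superchannels $\Theta$, and the *one-shot $\epsilon$-error bidirectional classical communication cost* is $$S^{(1)}_{\leftrightarrow,\epsilon}(\mathcal N)=\log\inf\{m\in\mathbb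 N: m\ge1,\ e_{\mathrm{NS}}(\Upsilon_m,\mathcal N)\le\epsilon\}.$$ **Theorem.** For every bipartite quantum channel $\mathcal N_{A_0B_0\to A_1B_1}$ and every $\epsilon\ge0$, $$S^{(1)}_{\leftrightarrow,\epsilon}(\mathcal N)\ \ge\ \mathfrak D_{\max}^{\leftrightarrow,\epsilon}(\mathcal N).$$ In particular, for $\epsilon=0$, $S^{(1)}_{\leftrightarrow,0}(\mathcal N)\ge\mathfrak D_{\max}^{\leftrightarrow}(\mathcal N)$. -/

import Mathlib

open scoped ENNReal NNReal Kronecker MatrixOrder ComplexOrder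

noncomputable section

namespace BiComm

/-! ### Linear maps between matrix algebras

A finite-dimensional quantum system is represented by a finite index type `a` (an orthonormal
basis of its Hilbert space), operators on it by `Matrix a a ℂ`, and a composite system by the
product of the index types. -/

/-- Linear maps from operators on the system `a` to operators on the system `b`. -/
abbrev QMap (a b : Type*) : Type _ :=
  Matrix a a ℂ →ₗ[ℂ] Matrix b b ℂ

/-- The block `⟨p| X |q⟩` of an operator on `r ⊗ a`, an operator on `a`. -/
def block {r a : Type*} (p q : r) (X : Matrix (r × a) (r × a) ℂ) : Matrix a a ℂ :=
  Matrix.of fun i j => X (p, i) (q, j)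

/-- The map `id_r ⊗ Φ`: apply `Φ` to every block. -/
def idTensor (r : Type*) {a b : Type*} (Φ : QMap a b) : QMap (r × a) (r × b) where
  toFun X := Matrix.of fun p q => Φ (block p.1 q.1 X) p.2 q.2
  map_add' X Y := by
    ext p q
    have h : block p.1 q.1 (X + Y) = block p.1 q.1 X + block p.1 q.1 Y := rfl
    simp [h]
  map_smul' c X := by
    ext p q
    have h : block p.1 q.1 (c • X) = c • block p.1 q.1 X := rfl
    simp [h]

/-- Complete positivity: `id_k ⊗ Φ` is positive for every `k`. -/
def IsCP {a b : Type*} (Φ : QMap a b) : Prop :=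
  ∀ (k : ℕ) (X : Matrix (Fin k × a) (Fin k × a) ℂ),
    X.PosSemidef → (idTensor (Fin k) Φ X).PosSemidef

/-- Trace preservation. -/
def IsTP {a b : Type*} [Fintype a] [Fintype b] (Φ : QMap a b) : Prop :=
  ∀ X : Matrix a a ℂ, (Φ X).trace = X.trace

/-- Quantum channels: completely positive trace-preserving maps. -/
structure IsChannel {a b : Type*} [Fintype a] [Fintype b] (Φ : QMap a b) : Prop where
  cp : IsCP Φ
  tp : IsTP Φ

/-! ### Replacement channels and non-signalling bipartite channels -/

/-- Partial trace over the first tensor factor. -/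
def traceFst (a b : Type*) [Fintype a] : QMap (a × b) b where
  toFun X := Matrix.of fun j j' => ∑ i, X (i, j) (i, j')
  map_add' X Y := by ext; simp [Finset.sum_add_distrib]
  map_smul' c X := by ext; simp [Finset.mul_sum]

/-- Partial trace over the second tensor factor. -/
def traceSnd (a b : Type*) [Fintype b] : QMap (a × b) a where
  toFun X := Matrix.of fun i i' => ∑ j, X (i, j) (i', j)
  map_add' X Y := by ext; simp [Finset.sum_add_distrib]
  map_smul' c X := by ext; simp [Finset.mul_sum]

/-- The maximally mixed state `1 / d`. -/
def maxMixed (a : Type*) [Fintype a] [DecidableEq a] : Matrix a a ℂ :=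
  (Fintype.card a : ℂ)⁻¹ • (1 : Matrix a a ℂ)

/-- The replacement channel `X ↦ π_a ⊗ tr_a X` on the first factor of `a ⊗ b`. -/
def replaceFst (a b : Type*) [Fintype a] [DecidableEq a] : QMap (a × b) (a × b) where
  toFun X := maxMixed a ⊗ₖ traceFst a b X
  map_add' X Y := by rw [map_add, Matrix.kronecker_add]
  map_smul' c X := by rw [map_smul, Matrix.kronecker_smul, RingHom.id_apply]

/-- The replacement channel `X ↦ tr_b X ⊗ π_b` on the second factor of `a ⊗ b`. -/
def replaceSnd (a b : Type*) [Fintype b] [DecidableEq b] : QMap (a × b) (a × b) where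
  toFun X := traceSnd a b X ⊗ₖ maxMixed b
  map_add' X Y := by rw [map_add, Matrix.add_kronecker]
  map_smul' c X := by rw [map_smul, Matrix.smul_kronecker, RingHom.id_apply]

/-- Non-signalling bipartite channels `A₀B₀ → A₁B₁` (non-signalling in both directions); Alice
holds the first and Bob the second tensor factor. -/
structure IsNonSignalling {a₀ b₀ a₁ b₁ : Type*}
    [Fintype a₀] [DecidableEq a₀] [Fintype b₀] [DecidableEq b₀]
    [Fintype a₁] [DecidableEq a₁] [Fintype b₁] [DecidableEq b₁]
    (N : QMap (a₀ × b₀) (a₁ × b₁)) : Prop where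
  channel : IsChannel N
  /-- Alice cannot signal to Bob. -/
  aliceToBob : replaceFst a₁ b₁ ∘ₗ N = replaceFst a₁ b₁ ∘ₗ N ∘ₗ replaceFst a₀ b₀
  /-- Bob cannot signal to Alice. -/
  bobToAlice : replaceSnd a₁ b₁ ∘ₗ N = replaceSnd a₁ b₁ ∘ₗ N ∘ₗ replaceSnd a₀ b₀

/-! ### Superchannels -/

/-- Supermaps `(a → b) → (c → d)`: linear maps between spaces of linear maps. -/
abbrev Supermap (a b c d : Type*) : Type _ :=
  QMap a b →ₗ[ℂ] QMap c d

/-- The component `X ↦ ⟨k| N(|i⟩⟨j| ⊗ X) |l⟩` of a map `N : r₀ ⊗ a → r₁ ⊗ b`, so that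
`N = ∑ E_{ijkl} ⊗ component i j k l N` with `E_{ijkl} = (Z ↦ ⟨i|Z|j⟩ |k⟩⟨l|)`. -/
def component {r₀ r₁ a b : Type*} [DecidableEq r₀] (i j : r₀) (k l : r₁)
    (N : QMap (r₀ × a) (r₁ × b)) : QMap a b where
  toFun X := block k l (N (Matrix.single i j (1 : ℂ) ⊗ₖ X))
  map_add' X Y := by rw [Matrix.kronecker_add, map_add]; rfl
  map_smul' c X := by rw [Matrix.kronecker_smul, map_smul]; rfl

/-- The supermap `I_R ⊗ Θ`, with `I_R` the identity supermap on maps `r₀ → r₁`: it applies `Θ` to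
every component of `N`. -/
def idSuper (r₀ r₁ : Type*) [Fintype r₀] [DecidableEq r₀] {a b c d : Type*}
    (Θ : Supermap a b c d) (N : QMap (r₀ × a) (r₁ × b)) : QMap (r₀ × c) (r₁ × d) where
  toFun Y := Matrix.of fun p q =>
    ∑ i, ∑ j, Θ (component i j p.1 q.1 N) (block i j Y) p.2 q.2
  map_add' X Y := by
    ext p q
    have h : ∀ i j, block i j (X + Y) = block i j X + block i j Y := fun _ _ => rfl
    simp [h, Finset.sum_add_distrib]
  map_smul' c X := by
    ext p q
    have h : ∀ i j, block i j (c • X) = c • block i j X := fun _ _ => rfl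
    simp [h, Finset.mul_sum]

/-- Superchannels: `I_R ⊗ Θ` maps channels to channels, for all reference systems `R₀, R₁`. -/
def IsSuperchannel {a b c d : Type*} [Fintype a] [Fintype b] [Fintype c] [Fintype d]
    (Θ : Supermap a b c d) : Prop :=
  ∀ (r₀ r₁ : ℕ) (N : QMap (Fin r₀ × a) (Fin r₁ × b)),
    IsChannel N → IsChannel (idSuper (Fin r₀) (Fin r₁) Θ N)

/-- Non-signalling bipartite superchannels `(Ā₀B̄₀ → Ā₁B̄₁) → (A₀B₀ → A₁B₁)`. A replacement
channel acts on maps by composition at its input or its output system. The equations are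
equalities of supermaps. -/
structure IsNSSuperchannel {a₀' b₀' a₁' b₁' a₀ b₀ a₁ b₁ : Type*}
    [Fintype a₀'] [DecidableEq a₀'] [Fintype b₀'] [DecidableEq b₀']
    [Fintype a₁'] [DecidableEq a₁'] [Fintype b₁'] [DecidableEq b₁']
    [Fintype a₀] [DecidableEq a₀] [Fintype b₀] [DecidableEq b₀]
    [Fintype a₁] [DecidableEq a₁] [Fintype b₁] [DecidableEq b₁]
    (Θ : Supermap (a₀' × b₀') (a₁' × b₁') (a₀ × b₀) (a₁ × b₁)) : Prop where
  superchannel : IsSuperchannel Θ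
  alice_input : ∀ F : QMap (a₀' × b₀') (a₁' × b₁'),
    replaceFst a₁ b₁ ∘ₗ Θ (F ∘ₗ replaceFst a₀' b₀') ∘ₗ replaceFst a₀ b₀
      = replaceFst a₁ b₁ ∘ₗ Θ (F ∘ₗ replaceFst a₀' b₀')
  alice_output : ∀ F : QMap (a₀' × b₀') (a₁' × b₁'),
    replaceFst a₁ b₁ ∘ₗ Θ (replaceFst a₁' b₁' ∘ₗ F) = replaceFst a₁ b₁ ∘ₗ Θ F
  bob_input : ∀ F : QMap (a₀' × b₀') (a₁' × b₁'),
    replaceSnd a₁ b₁ ∘ₗ Θ (F ∘ₗ replaceSnd a₀' b₀') ∘ₗ replaceSnd a₀ b₀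
      = replaceSnd a₁ b₁ ∘ₗ Θ (F ∘ₗ replaceSnd a₀' b₀')
  bob_output : ∀ F : QMap (a₀' × b₀') (a₁' × b₁'),
    replaceSnd a₁ b₁ ∘ₗ Θ (replaceSnd a₁' b₁' ∘ₗ F) = replaceSnd a₁ b₁ ∘ₗ Θ F

/-! ### Trace norm and diamond norm -/

/-- The trace norm `‖X‖₁ = tr √(X† X)`. -/
def traceNorm {a : Type*} [Fintype a] [DecidableEq a] (X : Matrix a a ℂ) : ℝ :=
  (CFC.sqrt (X.conjTranspose * X)).trace.re

/-- The diamond norm `sup_k sup_{‖X‖₁ ≤ 1} ‖(id_k ⊗ F)(X)‖₁`. -/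
def diamondNorm {a b : Type*} [Fintype a] [DecidableEq a] [Fintype b] [DecidableEq b]
    (F : QMap a b) : ℝ≥0∞ :=
  ⨆ (k : ℕ) (X : Matrix (Fin k × a) (Fin k × a) ℂ) (_ : traceNorm X ≤ 1),
    ENNReal.ofReal (traceNorm (idTensor (Fin k) F X))

/-! ### Max-relative entropies -/

/-- The max-relative entropy `log₂ min {t | ρ ≤ t σ}` of positive semidefinite operators; it is `⊤`
if no such `t` exists. (The logarithm is increasing, so it may be taken inside the infimum.) -/
def dMaxState {a : Type*} [Fintype a] (ρ σ : Matrix a a ℂ) : EReal :=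
  ⨅ (t : ℝ) (_ : 0 < t ∧ ((t : ℂ) • σ - ρ).PosSemidef), ((Real.logb 2 t : ℝ) : EReal)

/-- The channel max-relative entropy: the supremum of the max-relative entropies of the outputs
over all pure states `ψ` of `R ⊗ A` with `R` a copy of `A`. -/
def dMaxChannel {a b : Type*} [Fintype a] [Fintype b] (N E : QMap a b) : EReal :=
  ⨆ (ψ : a × a → ℂ) (_ : ∑ i, ‖ψ i‖ ^ 2 = 1),
    dMaxState (idTensor a N (Matrix.vecMulVec ψ (star ψ)))
      (idTensor a E (Matrix.vecMulVec ψ (star ψ)))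

section Bipartite

variable {a₀ b₀ a₁ b₁ : Type*}
  [Fintype a₀] [DecidableEq a₀] [Fintype b₀] [DecidableEq b₀]
  [Fintype a₁] [DecidableEq a₁] [Fintype b₁] [DecidableEq b₁]

/-- The max-relative entropy of bidirectional classical communication. -/
def dMaxBi (N : QMap (a₀ × b₀) (a₁ × b₁)) : EReal :=
  ⨅ (E : QMap (a₀ × b₀) (a₁ × b₁)) (_ : IsNonSignalling E), dMaxChannel N E

/-- The `ε`-smooth max-relative entropy of bidirectional classical communication. -/
def dMaxBiSmooth (ε : ℝ≥0) (N : QMap (a₀ × b₀) (a₁ × b₁)) : EReal :=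
  ⨅ (M : QMap (a₀ × b₀) (a₁ × b₁)) (_ : IsChannel M ∧ diamondNorm (M - N) / 2 ≤ ε), dMaxBi M

end Bipartite

/-! ### Channel simulation and the communication cost -/

/-- The minimum error of simulation from `N` to `M` via non-signalling bipartite superchannels. -/
def simError {a₀' b₀' a₁' b₁' a₀ b₀ a₁ b₁ : Type*}
    [Fintype a₀'] [DecidableEq a₀'] [Fintype b₀'] [DecidableEq b₀']
    [Fintype a₁'] [DecidableEq a₁'] [Fintype b₁'] [DecidableEq b₁']
    [Fintype a₀] [DecidableEq a₀] [Fintype b₀] [DecidableEq b₀]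
    [Fintype a₁] [DecidableEq a₁] [Fintype b₁] [DecidableEq b₁]
    (N : QMap (a₀' × b₀') (a₁' × b₁')) (M : QMap (a₀ × b₀) (a₁ × b₁)) : ℝ≥0∞ :=
  (⨅ (Θ : Supermap (a₀' × b₀') (a₁' × b₁') (a₀ × b₀) (a₁ × b₁)) (_ : IsNSSuperchannel Θ),
    diamondNorm (Θ N - M)) / 2

/-- The noiseless bidirectional classical channel
`X ↦ ∑_{k,l} ⟨kl| X |kl⟩ |lk⟩⟨lk|`: it exchanges the classical messages `k` of Alice and `l` of
Bob, `m` possible messages each. -/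
def noiselessBi (m : ℕ) : QMap (Fin m × Fin m) (Fin m × Fin m) where
  toFun X := ∑ k : Fin m, ∑ l : Fin m, X (k, l) (k, l) • Matrix.single (l, k) (l, k) (1 : ℂ)
  map_add' X Y := by simp only [Matrix.add_apply, add_smul, Finset.sum_add_distrib]
  map_smul' c X := by
    simp only [Matrix.smul_apply, smul_assoc, Finset.smul_sum, RingHom.id_apply]

/-- The one-shot `ε`-error bidirectional classical communication cost `log₂ inf {m | …}` via
non-signalling bipartite superchannels, over positive integers `m`; it is `⊤` if there is no such
`m`. -/
def commCost {a₀ b₀ a₁ b₁ : Type*}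
    [Fintype a₀] [DecidableEq a₀] [Fintype b₀] [DecidableEq b₀]
    [Fintype a₁] [DecidableEq a₁] [Fintype b₁] [DecidableEq b₁]
    (ε : ℝ≥0) (N : QMap (a₀ × b₀) (a₁ × b₁)) : EReal :=
  ⨅ (m : ℕ) (_ : 0 < m ∧ simError (noiselessBi m) N ≤ ε), ((Real.logb 2 m : ℝ) : EReal)

end BiComm

end

/-!
The noiseless channel `Υ_m` is dominated by a single non-signalling channel with factor `m`, and
non-signalling superchannels transport this domination to whatever they simulate.

Let Alice and Bob share a uniformly random `s : Fin m`, and let the exchanged messages both be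
shifted by `s`, so that `(k, l)` becomes `(l + s, k + s)`. Each output alone is uniform and
independent of both inputs, hence the averaged channel `E` (`randomExchange`) is non-signalling. The
value `s = 0` occurs with probability `1 / m` and gives `Υ_m`, so `m E - Υ_m` is the sum of the
channels for `s ≠ 0` and is completely positive
(`card_smul_randomExchange_sub_noiselessBi`). If `Θ` is a non-signalling superchannel, then `Θ E` is
again non-signalling (`IsNSSuperchannel.isNonSignalling`), and `m Θ(E) - Θ(Υ_m)` is a sum of images
of channels under `Θ`, hence completely positive. Therefore `D_max(Θ(Υ_m) ‖ Θ(E)) ≤ log m`, and the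
channel `M = Θ(Υ_m)` is a candidate in the smoothing.

The simulation error is an infimum over `Θ` which need not be attained a priori, while the smoothing
requires a channel within distance exactly `ε`. So take `Θ_n` with error at most `ε` in the limit.
The channels between two fixed finite-dimensional systems form a compact set
(`exists_tendsto_of_isChannel`), so `Θ_n(Υ_m)` and `Θ_n(E)` converge along a common ultrafilter, to
`M` and `E'`, say. Complete positivity of `m E' - M` and the non-signalling property of `E'` are
closed conditions, and the diamond norm is lower semicontinuous (`diamondNorm_le_of_tendsto`), so
that `M` lies within `ε` of `N`. For `ε = 0` the diamond norm separates points
(`eq_zero_of_diamondNorm_eq_zero`), hence `M = N`.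
-/

namespace BiComm

open Filter Topology

/-! ### Trace norm and positive semidefinite matrices -/

open scoped Matrix.Norms.L2Operator in
/-- The L2 operator norm makes matrices a C⋆-algebra, where `CFC.sqrt` is continuous on nonnegative
elements; its topology is the entrywise one. -/
theorem continuous_traceNorm {a : Type*} [Fintype a] [DecidableEq a] :
    Continuous (traceNorm : Matrix a a ℂ → ℝ) := by
  have h : Continuous fun X : Matrix a a ℂ => CFC.sqrt (X.conjTranspose * X) :=
    CFC.continuousOn_sqrt.comp_continuous (by fun_prop)
      fun X => (Matrix.posSemidef_conjTranspose_mul_self X).nonneg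
  exact Complex.continuous_re.comp h.matrix_trace

theorem traceNorm_zero {a : Type*} [Fintype a] [DecidableEq a] :
    traceNorm (0 : Matrix a a ℂ) = 0 := by
  simp [traceNorm]

theorem eq_zero_of_traceNorm_nonpos {a : Type*} [Fintype a] [DecidableEq a] {X : Matrix a a ℂ}
    (h : traceNorm X ≤ 0) : X = 0 := by
  have hX := (Matrix.posSemidef_conjTranspose_mul_self X).nonneg
  have hS := Matrix.nonneg_iff_posSemidef.1 (CFC.sqrt_nonneg (X.conjTranspose * X))
  have ht : (CFC.sqrt (X.conjTranspose * X)).trace = 0 := by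
    have h0 := Complex.nonneg_iff.1 hS.trace_nonneg
    exact Complex.ext (le_antisymm h h0.1) h0.2.symm
  have h1 : CFC.sqrt (X.conjTranspose * X) = 0 := hS.trace_eq_zero_iff.1 ht
  rw [CFC.sqrt_eq_zero_iff _ hX] at h1
  exact Matrix.conjTranspose_mul_self_eq_zero.1 h1

theorem isClosed_posSemidef {a : Type*} [Fintype a] :
    IsClosed {X : Matrix a a ℂ | X.PosSemidef} := by
  simp only [Matrix.posSemidef_iff_dotProduct_mulVec, Set.ofPred_and, Set.ofPred_forall]
  refine IsClosed.inter ?_ (isClosed_iInter fun v => ?_)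
  · exact isClosed_eq (by fun_prop) continuous_id
  · exact isClosed_le continuous_const (by fun_prop)

/-- Every `2 × 2` principal minor is nonnegative, which bounds an off-diagonal entry by the diagonal
ones. -/
theorem _root_.Matrix.PosSemidef.norm_apply_le {a : Type*} [Fintype a] [DecidableEq a]
    {A : Matrix a a ℂ} (hA : A.PosSemidef) (p q : a) : ‖A p q‖ ≤ ‖A.trace‖ := by
  have hd : ∀ r, ‖A r r‖ ≤ ‖A.trace‖ := fun r => by
    have h1 : A r r ≤ A.trace :=
      Finset.single_le_sum (f := fun i => A i i) (fun i _ => hA.diag_nonneg) (Finset.mem_univ r)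
    exact CStarAlgebra.norm_le_norm_of_nonneg_of_le hA.diag_nonneg h1
  have hdet := (hA.submatrix ![p, q]).det_nonneg
  rw [Matrix.det_fin_two] at hdet
  simp only [Matrix.submatrix_apply, Matrix.cons_val_zero, Matrix.cons_val_one] at hdet
  rw [← hA.isHermitian.apply q p, sub_nonneg] at hdet
  have h2 := CStarAlgebra.norm_le_norm_of_nonneg_of_le (mul_star_self_nonneg (A p q)) hdet
  rw [norm_mul, norm_mul, norm_star] at h2
  refine abs_le_of_sq_le_sq' (a := ‖A p q‖) ?_ (norm_nonneg _) |>.2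
  nlinarith [hd p, hd q, norm_nonneg (A p p), norm_nonneg (A q q), norm_nonneg A.trace]

/-! ### Channels and superchannels -/

variable {a b c d : Type*}

theorem idTensor_apply {r : Type*} (Φ : QMap a b) (X : Matrix (r × a) (r × a) ℂ) (p q : r × b) :
    idTensor r Φ X p q = Φ (block p.1 q.1 X) p.2 q.2 := rfl

/-- Complete positivity, stated with the reference systems `Fin k`, holds for an arbitrary finite
reference system. -/
theorem IsCP.posSemidef_idTensor {Φ : QMap a b} (hΦ : IsCP Φ) {r : Type*} [Fintype r]
    {X : Matrix (r × a) (r × a) ℂ} (hX : X.PosSemidef) : (idTensor r Φ X).PosSemidef := by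
  let e := Fintype.equivFin r
  have h := (hΦ _ _ (hX.submatrix (Prod.map e.symm id))).submatrix (Prod.map e id)
  have hb : ∀ i j, block (e i) (e j) (X.submatrix (Prod.map e.symm id) (Prod.map e.symm id)) =
      block i j X := by
    intro i j
    ext
    simp [block]
  convert h using 1
  ext p q
  simp [idTensor_apply, hb]

theorem IsChannel.idTensor [Fintype a] [Fintype b] {Φ : QMap a b} (hΦ : IsChannel Φ)
    (r : Type*) [Fintype r] : IsChannel (idTensor r Φ) where
  cp k X hX := by
    have h := hΦ.cp.posSemidef_idTensor (hX.submatrix (Equiv.prodAssoc (Fin k) r a))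
    exact h.submatrix (Equiv.prodAssoc (Fin k) r b).symm
  tp X := by
    simp only [Matrix.trace, Matrix.diag, Fintype.sum_prod_type, idTensor_apply]
    exact Finset.sum_congr rfl fun i _ => hΦ.tp (block i i X)

theorem IsChannel.of_idTensor [Fintype a] [Fintype b] {Φ : QMap a b}
    (hΦ : IsChannel (BiComm.idTensor (Fin 1) Φ)) : IsChannel Φ where
  cp k X hX := by
    have h := hΦ.cp k (X.submatrix (Prod.map id Prod.snd) (Prod.map id Prod.snd))
      (hX.submatrix _)
    exact h.submatrix fun p : Fin k × b => (p.1, ((0 : Fin 1), p.2))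
  tp X := by
    have h := hΦ.tp (X.submatrix Prod.snd Prod.snd)
    have hb : block (0 : Fin 1) 0 (X.submatrix Prod.snd Prod.snd) = X := rfl
    simpa [hb, Matrix.trace, Fintype.sum_prod_type, idTensor_apply] using h

theorem idSuper_idTensor (Θ : Supermap a b c d) (F : QMap a b) :
    idSuper (Fin 1) (Fin 1) Θ (idTensor (Fin 1) F) = idTensor (Fin 1) (Θ F) := by
  have h : ∀ k l : Fin 1, component (0 : Fin 1) (0 : Fin 1) k l (idTensor (Fin 1) F) = F := by
    intro k l
    ext X i j
    obtain rfl := Subsingleton.elim k 0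
    obtain rfl := Subsingleton.elim l 0
    have hb : block (0 : Fin 1) (0 : Fin 1) (Matrix.single (0 : Fin 1) 0 (1 : ℂ) ⊗ₖ X) = X := by
      ext; simp [block]
    change F (block 0 0 (Matrix.single (0 : Fin 1) 0 (1 : ℂ) ⊗ₖ X)) i j = F X i j
    rw [hb]
  ext Y p q
  simp only [idSuper, LinearMap.coe_mk, AddHom.coe_mk, Matrix.of_apply, Fin.sum_univ_one, h,
    idTensor_apply]
  rw [Subsingleton.elim p.1 0, Subsingleton.elim q.1 0]

/-- A superchannel maps channels to channels: this is the case of one-dimensional reference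
systems. -/
theorem IsSuperchannel.isChannel [Fintype a] [Fintype b] [Fintype c] [Fintype d]
    {Θ : Supermap a b c d} (hΘ : IsSuperchannel Θ) {F : QMap a b} (hF : IsChannel F) :
    IsChannel (Θ F) := by
  have h := hΘ 1 1 _ (hF.idTensor (Fin 1))
  rw [idSuper_idTensor] at h
  exact h.of_idTensor

theorem IsCP.zero : IsCP (0 : QMap a b) := fun _ _ _ => Matrix.PosSemidef.zero

theorem IsCP.add {Φ Ψ : QMap a b} (hΦ : IsCP Φ) (hΨ : IsCP Ψ) : IsCP (Φ + Ψ) :=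
  fun k X hX => (hΦ k X hX).add (hΨ k X hX)

theorem IsCP.sum {ι : Type*} {Φ : ι → QMap a b} (s : Finset ι) (h : ∀ i ∈ s, IsCP (Φ i)) :
    IsCP (∑ i ∈ s, Φ i) :=
  Finset.sum_induction _ IsCP (fun _ _ => IsCP.add) IsCP.zero h

theorem IsCP.smul {Φ : QMap a b} (hΦ : IsCP Φ) {t : ℂ} (ht : 0 ≤ t) : IsCP (t • Φ) :=
  fun k X hX => (hΦ k X hX).smul ht

theorem IsChannel.average [Fintype a] [Fintype b] {ι : Type*} [Fintype ι] [Nonempty ι]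
    {Φ : ι → QMap a b} (h : ∀ i, IsChannel (Φ i)) :
    IsChannel ((Fintype.card ι : ℂ)⁻¹ • ∑ i, Φ i) where
  cp := (IsCP.sum _ fun i _ => (h i).cp).smul (by positivity)
  tp X := by
    have hs : ∀ i, (Φ i X).trace = X.trace := fun i => (h i).tp X
    simp [Matrix.trace_sum, hs]

/-! ### Compactness of the set of channels -/

theorem tendsto_idTensor {ι : Type*} {l : Filter ι} {Φ : ι → QMap a b} {Ψ : QMap a b}
    (h : ∀ X, Tendsto (fun i => Φ i X) l (𝓝 (Ψ X))) (r : Type*)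
    (X : Matrix (r × a) (r × a) ℂ) :
    Tendsto (fun i => idTensor r (Φ i) X) l (𝓝 (idTensor r Ψ X)) := by
  refine tendsto_pi_nhds.2 fun p => tendsto_pi_nhds.2 fun q => ?_
  exact ((continuous_apply q.2).comp (continuous_apply p.2)).continuousAt.tendsto.comp
    (h (block p.1 q.1 X))

theorem IsCP.of_tendsto [Fintype b] {ι : Type*} {l : Filter ι} [l.NeBot]
    {Φ : ι → QMap a b} {Ψ : QMap a b} (h : ∀ X, Tendsto (fun i => Φ i X) l (𝓝 (Ψ X)))
    (hΦ : ∀ i, IsCP (Φ i)) : IsCP Ψ :=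
  fun k X hX => isClosed_posSemidef.mem_of_tendsto (tendsto_idTensor h _ X)
    (Eventually.of_forall fun i => hΦ i k X hX)

theorem IsTP.of_tendsto [Fintype a] [Fintype b] {ι : Type*} {l : Filter ι} [l.NeBot]
    {Φ : ι → QMap a b} {Ψ : QMap a b}
    (h : ∀ X, Tendsto (fun i => Φ i X) l (𝓝 (Ψ X))) (hΦ : ∀ i, IsTP (Φ i)) : IsTP Ψ := by
  intro X
  refine tendsto_nhds_unique
    ((Continuous.matrix_trace continuous_id).continuousAt.tendsto.comp (h X)) ?_
  refine tendsto_const_nhds.congr fun i => (hΦ i X).symm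

/-- The numbers `Φ(|i⟩⟨j|)_{pq}` are the entries of the Choi matrix of `Φ`, which is positive
semidefinite with trace `Fintype.card a`. -/
theorem IsChannel.norm_apply_single_le [Fintype a] [DecidableEq a] [Fintype b] [DecidableEq b]
    {Φ : QMap a b} (hΦ : IsChannel Φ) (i j : a) (p q : b) :
    ‖Φ (Matrix.single i j 1) p q‖ ≤ Fintype.card a := by
  -- The unnormalised maximally entangled vector; its projector has blocks `|i⟩⟨j|`.
  let ω : a × a → ℂ := fun x => if x.1 = x.2 then 1 else 0
  have hb : ∀ i j, block i j (Matrix.vecMulVec ω (star ω)) = Matrix.single i j 1 := by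
    intro i j
    ext k l
    simp [block, Matrix.vecMulVec_apply, ω, Matrix.single_apply, ← ite_and, and_comm]
  have h := (hΦ.cp.posSemidef_idTensor
    (Matrix.posSemidef_vecMulVec_self_star ω)).norm_apply_le (i, p) (j, q)
  rw [idTensor_apply, hb, (hΦ.idTensor a).tp] at h
  refine h.trans (le_of_eq ?_)
  simp [Matrix.trace, Matrix.vecMulVec_apply, ω, Fintype.sum_prod_type]

/-- Compactness of the set of channels. It is phrased with ultrafilters, so that several families of
channels converge along the same filter. -/
theorem exists_tendsto_of_isChannel [Fintype a] [Fintype b]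
    {ι : Type*} (U : Ultrafilter ι) {Φ : ι → QMap a b} (hΦ : ∀ i, IsChannel (Φ i)) :
    ∃ Ψ : QMap a b, IsChannel Ψ ∧ ∀ X, Tendsto (fun i => Φ i X) U (𝓝 (Ψ X)) := by
  classical
  have hlim : ∀ i j p q, ∃ z : ℂ, Tendsto (fun n => Φ n (Matrix.single i j 1) p q) U (𝓝 z) := by
    intro i j p q
    obtain ⟨z, -, hz⟩ := (isCompact_closedBall (0 : ℂ) (Fintype.card a)).ultrafilter_le_nhds
      (U.map fun n => Φ n (Matrix.single i j 1) p q) (by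
        rw [le_principal_iff]
        exact mem_map.2 <| Eventually.of_forall fun n => mem_closedBall_zero_iff.2
          ((hΦ n).norm_apply_single_le i j p q))
    exact ⟨z, hz⟩
  choose z hz using hlim
  let Ψ : QMap a b := ∑ i, ∑ j,
    (Matrix.entryLinearMap ℂ ℂ i j).smulRight (Matrix.of (z i j))
  have hexp : ∀ (Λ : QMap a b) X, Λ X = ∑ i, ∑ j, X i j • Λ (Matrix.single i j 1) := by
    intro Λ X
    conv_lhs => rw [Matrix.matrix_eq_sum_single X]
    simp [← map_smul, Matrix.smul_single]
  have hΨ : ∀ X, Tendsto (fun n => Φ n X) U (𝓝 (Ψ X)) := by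
    intro X
    have : Ψ X = ∑ i, ∑ j, X i j • Matrix.of (z i j) := by
      simp [Ψ, LinearMap.sum_apply]
    rw [this]
    simp only [hexp (Φ _) X]
    refine tendsto_finsetSum _ fun i _ => tendsto_finsetSum _ fun j _ => Tendsto.const_smul ?_ _
    exact tendsto_pi_nhds.2 fun p => tendsto_pi_nhds.2 fun q => hz i j p q
  exact ⟨Ψ, ⟨IsCP.of_tendsto hΨ fun n => (hΦ n).cp, IsTP.of_tendsto hΨ fun n => (hΦ n).tp⟩, hΨ⟩

/-- Lower semicontinuity of the diamond norm with respect to pointwise convergence. -/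
theorem diamondNorm_le_of_tendsto [Fintype a] [DecidableEq a] [Fintype b] [DecidableEq b]
    {ι : Type*} {l : Filter ι} [l.NeBot] {Φ : ι → QMap a b} {Ψ : QMap a b}
    (h : ∀ X, Tendsto (fun i => Φ i X) l (𝓝 (Ψ X))) {u : ι → ℝ≥0∞} {c : ℝ≥0∞}
    (hu : Tendsto u l (𝓝 c)) (hΦ : ∀ i, diamondNorm (Φ i) ≤ u i) : diamondNorm Ψ ≤ c := by
  refine iSup_le fun k => iSup_le fun X => iSup_le fun hX => ?_
  refine le_of_tendsto_of_tendsto' ((ENNReal.continuous_ofReal.comp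
    continuous_traceNorm).continuousAt.tendsto.comp (tendsto_idTensor h _ X)) hu fun i => ?_
  refine le_trans ?_ (hΦ i)
  exact le_iSup₂_of_le (f := fun (k : ℕ) (X : Matrix (Fin k × a) (Fin k × a) ℂ) =>
    ⨆ _ : traceNorm X ≤ 1, ENNReal.ofReal (traceNorm (idTensor (Fin k) (Φ i) X))) k X
    (le_iSup_of_le hX le_rfl)

/-- One-dimensional reference systems suffice to see that the diamond norm separates points. -/
theorem eq_zero_of_diamondNorm_eq_zero [Fintype a] [DecidableEq a] [Fintype b] [DecidableEq b]
    {F : QMap a b} (hF : diamondNorm F = 0) : F = 0 := by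
  have h1 : ∀ X : Matrix (Fin 1 × a) (Fin 1 × a) ℂ, traceNorm X ≤ 1 →
      idTensor (Fin 1) F X = 0 := by
    intro X hX
    refine eq_zero_of_traceNorm_nonpos (ENNReal.ofReal_eq_zero.1 ?_)
    simp only [diamondNorm, ENNReal.iSup_eq_zero] at hF
    exact hF 1 X hX
  -- A small positive multiple of any `Y` has trace norm at most one.
  have h2 : ∀ Y : Matrix (Fin 1 × a) (Fin 1 × a) ℂ, idTensor (Fin 1) F Y = 0 := by
    intro Y
    have ht : Tendsto (fun t : ℝ => traceNorm (t • Y)) (𝓝[>] 0) (𝓝 0) := by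
      have hc : Continuous fun t : ℝ => traceNorm (t • Y) :=
        continuous_traceNorm.comp (by fun_prop)
      simpa [traceNorm_zero] using (hc.tendsto 0).mono_left nhdsWithin_le_nhds
    obtain ⟨t, ht1, ht0⟩ := ((ht.eventually (gt_mem_nhds one_pos)).and
      self_mem_nhdsWithin).exists
    have := h1 (t • Y) ht1.le
    rw [← Complex.coe_smul, map_smul, smul_eq_zero] at this
    exact this.resolve_left (by exact_mod_cast (ne_of_gt ht0))
  ext X i j
  exact congrFun (congrFun (h2 (X.submatrix Prod.snd Prod.snd)) (0, i)) (0, j)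

/-! ### The noiseless channel and the randomly shifted exchange -/

/-- The classical channel that measures in the computational basis and relabels the outcome: the
outcome `σ p` is output as `p`. Thus `σ` maps outputs to inputs. -/
noncomputable def measureRelabel {a b : Type*} [DecidableEq b] (σ : b ≃ a) : QMap a b where
  toFun X := Matrix.diagonal fun p => X (σ p) (σ p)
  map_add' X Y := by ext p q; by_cases h : p = q <;> simp [h]
  map_smul' c X := by ext p q; by_cases h : p = q <;> simp [h]

theorem measureRelabel_apply {a b : Type*} [DecidableEq b] (σ : b ≃ a) (X : Matrix a a ℂ) :
    measureRelabel σ X = Matrix.diagonal fun p => X (σ p) (σ p) := rfl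

/-- Complete positivity holds because `id_k ⊗ measureRelabel σ` sends `X` to the block diagonal
operator of the diagonal blocks `⟨σ p| X |σ p⟩`. -/
theorem isChannel_measureRelabel {a b : Type*} [Fintype a] [Fintype b] [DecidableEq b]
    (σ : b ≃ a) : IsChannel (measureRelabel σ) where
  cp k X hX := by
    have h : idTensor (Fin k) (measureRelabel σ) X =
        ∑ p : b, (X.submatrix (fun i => (i, σ p)) fun i => (i, σ p)) ⊗ₖ Matrix.single p p 1 := by
      ext ⟨i, p⟩ ⟨j, q⟩
      by_cases hpq : p = q
      · subst hpq
        simp [idTensor_apply, measureRelabel_apply, block, Matrix.sum_apply, Matrix.single_apply]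
      · have : ∀ x : b, ¬ (x = p ∧ x = q) := fun x hx => hpq (hx.1 ▸ hx.2)
        simp [idTensor_apply, measureRelabel_apply, Matrix.sum_apply, hpq, this]
    rw [h]
    refine Matrix.posSemidef_sum _ fun p _ => (hX.submatrix _).kronecker ?_
    rw [← Matrix.diagonal_single]
    exact Matrix.PosSemidef.diagonal (by simp [Pi.single_nonneg])
  tp X := by
    simpa [measureRelabel_apply, Matrix.trace] using σ.sum_comp fun i => X i i

/-- The exchange of the two messages followed by a shift of both by `s`, as the map from outputs to
inputs that `measureRelabel` expects: the output `(l + s, k + s)` comes from the input `(k, l)`. -/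
def exchangeShift {m : ℕ} [NeZero m] (s : Fin m) : Fin m × Fin m ≃ Fin m × Fin m :=
  (Equiv.prodComm _ _).trans ((Equiv.subRight s).prodCongr (Equiv.subRight s))

@[simp] theorem exchangeShift_apply {m : ℕ} [NeZero m] (s : Fin m) (p : Fin m × Fin m) :
    exchangeShift s p = (p.2 - s, p.1 - s) := rfl

/-- The exchange of two classical messages, both shifted by the same uniformly random `s`. -/
noncomputable def randomExchange (m : ℕ) [NeZero m] : QMap (Fin m × Fin m) (Fin m × Fin m) :=
  (Fintype.card (Fin m) : ℂ)⁻¹ • ∑ s : Fin m, measureRelabel (exchangeShift s)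

theorem noiselessBi_eq (m : ℕ) [NeZero m] :
    noiselessBi m = measureRelabel (exchangeShift (0 : Fin m)) := by
  ext X ⟨p₁, p₂⟩ ⟨q₁, q₂⟩
  simp only [noiselessBi, LinearMap.coe_mk, AddHom.coe_mk, measureRelabel_apply,
    exchangeShift_apply, sub_zero, Matrix.sum_apply, Matrix.smul_apply, Matrix.single_apply,
    Matrix.diagonal_apply]
  rw [Finset.sum_eq_single p₂ (by simp +contextual) (by simp),
    Finset.sum_eq_single p₁ (by simp +contextual) (by simp)]
  simp

theorem card_smul_randomExchange_sub_noiselessBi (m : ℕ) [NeZero m] :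
    (m : ℂ) • randomExchange m - noiselessBi m =
      ∑ s ∈ Finset.univ.erase (0 : Fin m), measureRelabel (exchangeShift s) := by
  have hm : (m : ℂ) ≠ 0 := NeZero.ne _
  rw [randomExchange, Fintype.card_fin, smul_inv_smul₀ hm, noiselessBi_eq,
    Finset.sum_erase_eq_sub (Finset.mem_univ _)]

theorem isChannel_randomExchange (m : ℕ) [NeZero m] : IsChannel (randomExchange m) :=
  IsChannel.average fun _ => isChannel_measureRelabel _

theorem trace_maxMixed (a : Type*) [Fintype a] [DecidableEq a] [Nonempty a] :
    (maxMixed a).trace = 1 := by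
  simp [maxMixed]

theorem trace_replaceFst {a b : Type*} [Fintype a] [DecidableEq a] [Fintype b] [Nonempty a]
    (X : Matrix (a × b) (a × b) ℂ) : (replaceFst a b X).trace = X.trace := by
  simp only [replaceFst, LinearMap.coe_mk, AddHom.coe_mk, Matrix.trace_kronecker, trace_maxMixed,
    one_mul]
  simpa [traceFst, Matrix.trace, Fintype.sum_prod_type] using Finset.sum_comm

theorem trace_replaceSnd {a b : Type*} [Fintype a] [Fintype b] [DecidableEq b] [Nonempty b]
    (X : Matrix (a × b) (a × b) ℂ) : (replaceSnd a b X).trace = X.trace := by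
  simp only [replaceSnd, LinearMap.coe_mk, AddHom.coe_mk, Matrix.trace_kronecker, trace_maxMixed,
    mul_one]
  simp [traceSnd, Matrix.trace, Fintype.sum_prod_type]

/-- The map `(s, i) ↦ (j - s, i - s)` is a bijection. -/
theorem sum_shift {m : ℕ} [NeZero m] (f : Fin m → Fin m → ℂ) (j : Fin m) :
    ∑ s, ∑ i, f (j - s) (i - s) = ∑ x, ∑ y, f x y := by
  rw [← (Equiv.subLeft j).sum_comp (fun x => ∑ y, f x y)]
  exact Finset.sum_congr rfl fun s _ => (Equiv.subRight s).sum_comp fun y => f (j - s) y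

/-- Bob's output is maximally mixed, whatever the input. -/
theorem traceFst_randomExchange (m : ℕ) [NeZero m]
    (X : Matrix (Fin m × Fin m) (Fin m × Fin m) ℂ) :
    traceFst _ _ (randomExchange m X) = X.trace • maxMixed (Fin m) := by
  ext j j'
  by_cases h : j = j'
  · subst h
    have hsum := sum_shift (fun x y => X (x, y) (x, y)) j
    simp [traceFst, randomExchange, maxMixed, measureRelabel_apply, Matrix.sum_apply,
      hsum, Matrix.trace, Fintype.sum_prod_type, mul_comm]
  · simp [traceFst, randomExchange, maxMixed, measureRelabel_apply, Matrix.sum_apply, h]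

/-- Alice's output is maximally mixed, whatever the input. -/
theorem traceSnd_randomExchange (m : ℕ) [NeZero m]
    (X : Matrix (Fin m × Fin m) (Fin m × Fin m) ℂ) :
    traceSnd _ _ (randomExchange m X) = X.trace • maxMixed (Fin m) := by
  ext j j'
  by_cases h : j = j'
  · subst h
    have hsum := sum_shift (fun x y => X (y, x) (y, x)) j
    rw [Finset.sum_comm (f := fun x y => X (y, x) (y, x))] at hsum
    simp [traceSnd, randomExchange, maxMixed, measureRelabel_apply, Matrix.sum_apply,
      hsum, Matrix.trace, Fintype.sum_prod_type, mul_comm]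
  · simp [traceSnd, randomExchange, maxMixed, measureRelabel_apply, Matrix.sum_apply, h]

theorem isNonSignalling_randomExchange (m : ℕ) [NeZero m] :
    IsNonSignalling (randomExchange m) where
  channel := isChannel_randomExchange m
  aliceToBob := by
    refine LinearMap.ext fun X => ?_
    change maxMixed _ ⊗ₖ traceFst _ _ _ = maxMixed _ ⊗ₖ traceFst _ _ (randomExchange m _)
    rw [traceFst_randomExchange, traceFst_randomExchange, trace_replaceFst]
  bobToAlice := by
    refine LinearMap.ext fun X => ?_
    change traceSnd _ _ _ ⊗ₖ maxMixed _ = traceSnd _ _ (randomExchange m _) ⊗ₖ maxMixed _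
    rw [traceSnd_randomExchange, traceSnd_randomExchange, trace_replaceSnd]

/-! ### Simulation by non-signalling superchannels -/

section Simulation

variable {a₀' b₀' a₁' b₁' a₀ b₀ a₁ b₁ : Type*}
  [Fintype a₀'] [DecidableEq a₀'] [Fintype b₀'] [DecidableEq b₀']
  [Fintype a₁'] [DecidableEq a₁'] [Fintype b₁'] [DecidableEq b₁']
  [Fintype a₀] [DecidableEq a₀] [Fintype b₀] [DecidableEq b₀]
  [Fintype a₁] [DecidableEq a₁] [Fintype b₁] [DecidableEq b₁]

/-- For each party, the output condition on `Θ` lets the replacement of the outer output be moved to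
the output of `E`, where non-signalling of `E` makes the input of `E` replaceable, and then the input
condition on `Θ` makes the outer input replaceable. -/
theorem IsNSSuperchannel.isNonSignalling
    {Θ : Supermap (a₀' × b₀') (a₁' × b₁') (a₀ × b₀) (a₁ × b₁)} (hΘ : IsNSSuperchannel Θ)
    {E : QMap (a₀' × b₀') (a₁' × b₁')} (hE : IsNonSignalling E) : IsNonSignalling (Θ E) where
  channel := hΘ.superchannel.isChannel hE.channel
  aliceToBob := by
    have h : replaceFst a₁ b₁ ∘ₗ Θ E =
        replaceFst a₁ b₁ ∘ₗ Θ (E ∘ₗ replaceFst a₀' b₀') := by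
      rw [← hΘ.alice_output E, hE.aliceToBob, hΘ.alice_output]
    rw [← LinearMap.comp_assoc, h, LinearMap.comp_assoc, hΘ.alice_input]
  bobToAlice := by
    have h : replaceSnd a₁ b₁ ∘ₗ Θ E =
        replaceSnd a₁ b₁ ∘ₗ Θ (E ∘ₗ replaceSnd a₀' b₀') := by
      rw [← hΘ.bob_output E, hE.bobToAlice, hΘ.bob_output]
    rw [← LinearMap.comp_assoc, h, LinearMap.comp_assoc, hΘ.bob_input]

theorem IsNonSignalling.of_tendsto {ι : Type*} {l : Filter ι} [l.NeBot]
    {Φ : ι → QMap (a₀ × b₀) (a₁ × b₁)} {Ψ : QMap (a₀ × b₀) (a₁ × b₁)}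
    (h : ∀ X, Tendsto (fun i => Φ i X) l (𝓝 (Ψ X))) (hΦ : ∀ i, IsNonSignalling (Φ i)) :
    IsNonSignalling Ψ where
  channel := ⟨.of_tendsto h fun i => (hΦ i).channel.cp, .of_tendsto h fun i => (hΦ i).channel.tp⟩
  aliceToBob := by
    refine LinearMap.ext fun X => ?_
    have hc := LinearMap.continuous_of_finiteDimensional (replaceFst a₁ b₁)
    refine tendsto_nhds_unique ((hc.tendsto _).comp (h X)) ?_
    refine ((hc.tendsto _).comp (h (replaceFst a₀ b₀ X))).congr fun i => ?_
    exact (LinearMap.congr_fun (hΦ i).aliceToBob X).symm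
  bobToAlice := by
    refine LinearMap.ext fun X => ?_
    have hc := LinearMap.continuous_of_finiteDimensional (replaceSnd a₁ b₁)
    refine tendsto_nhds_unique ((hc.tendsto _).comp (h X)) ?_
    refine ((hc.tendsto _).comp (h (replaceSnd a₀ b₀ X))).congr fun i => ?_
    exact (LinearMap.congr_fun (hΦ i).bobToAlice X).symm

theorem IsSuperchannel.isCP_card_smul_sub {c d : Type*} [Fintype c] [Fintype d]
    {m : ℕ} [NeZero m]
    {Θ : Supermap (Fin m × Fin m) (Fin m × Fin m) c d} (hΘ : IsSuperchannel Θ) :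
    IsCP ((m : ℂ) • Θ (randomExchange m) - Θ (noiselessBi m)) := by
  rw [← map_smul, ← map_sub, card_smul_randomExchange_sub_noiselessBi, map_sum]
  exact IsCP.sum _ fun s _ => (hΘ.isChannel (isChannel_measureRelabel _)).cp

theorem dMaxChannel_le {a b : Type*} [Fintype a] [Fintype b] {M E : QMap a b} {t : ℝ} (ht : 0 < t)
    (h : IsCP ((t : ℂ) • E - M)) : dMaxChannel M E ≤ (Real.logb 2 t : ℝ) := by
  refine iSup₂_le fun ψ _ => iInf₂_le_of_le t ⟨ht, ?_⟩ le_rfl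
  exact h.posSemidef_idTensor (Matrix.posSemidef_vecMulVec_self_star ψ)

theorem exists_isNSSuperchannel_diamondNorm_le
    {F : QMap (a₀' × b₀') (a₁' × b₁')} {N : QMap (a₀ × b₀) (a₁ × b₁)} {ε : ℝ≥0}
    (h : simError F N ≤ ε) {δ : ℝ≥0∞} (hδ : δ ≠ 0) :
    ∃ Θ : Supermap (a₀' × b₀') (a₁' × b₁') (a₀ × b₀) (a₁ × b₁),
      IsNSSuperchannel Θ ∧ diamondNorm (Θ F - N) ≤ ε * 2 + δ := by
  rw [simError, ENNReal.div_le_iff (by simp) (by simp)] at h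
  have h1 := h.trans_lt (ENNReal.lt_add_right (by finiteness) hδ)
  simp only [iInf_lt_iff] at h1
  obtain ⟨Θ, hΘ, hlt⟩ := h1
  exact ⟨Θ, hΘ, hlt.le⟩

/-- If `m` messages suffice for error `ε`, a limit of simulated channels has error at most `ε` and is
dominated, with factor `m`, by a limit of non-signalling channels. -/
theorem exists_dMaxBi_le_of_simError_le {m : ℕ} (hm : 0 < m) {N : QMap (a₀ × b₀) (a₁ × b₁)}
    {ε : ℝ≥0} (h : simError (noiselessBi m) N ≤ ε) :
    ∃ M : QMap (a₀ × b₀) (a₁ × b₁), (IsChannel M ∧ diamondNorm (M - N) / 2 ≤ ε) ∧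
      dMaxBi M ≤ (Real.logb 2 m : ℝ) := by
  have : NeZero m := ⟨hm.ne'⟩
  -- For `n = 0` the excess `δ` is `∞` and the bound is empty; only the limit `δ → 0` matters.
  have hex := fun n : ℕ => exists_isNSSuperchannel_diamondNorm_le h
    (δ := (n : ℝ≥0∞)⁻¹) (by simp)
  choose Θ hΘ hd using hex
  let U : Ultrafilter ℕ := hyperfilter ℕ
  obtain ⟨M, hM, hMlim⟩ := exists_tendsto_of_isChannel U
    (Φ := fun n => Θ n (noiselessBi m)) fun n => (hΘ n).superchannel.isChannel
      (noiselessBi_eq m ▸ isChannel_measureRelabel _)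
  have hNS := fun n => (hΘ n).isNonSignalling (isNonSignalling_randomExchange m)
  obtain ⟨E, -, hElim⟩ := exists_tendsto_of_isChannel U
    (Φ := fun n => Θ n (randomExchange m)) fun n => (hNS n).channel
  have hU : (U : Filter ℕ) ≤ atTop := Nat.hyperfilter_le_atTop
  refine ⟨M, ⟨hM, ?_⟩, iInf₂_le_of_le E (.of_tendsto hElim hNS) (dMaxChannel_le (by simpa) ?_)⟩
  · rw [ENNReal.div_le_iff (by simp) (by simp)]
    refine diamondNorm_le_of_tendsto (l := U) (fun X => (hMlim X).sub_const (N X)) ?_ hd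
    simpa using (ENNReal.tendsto_inv_nat_nhds_zero.mono_left hU).const_add ((ε : ℝ≥0∞) * 2)
  · rw [Complex.ofReal_natCast]
    exact IsCP.of_tendsto (l := U)
      (Φ := fun n => (m : ℂ) • Θ n (randomExchange m) - Θ n (noiselessBi m))
      (fun X => ((hElim X).const_smul (m : ℂ)).sub (hMlim X))
      fun n => (hΘ n).superchannel.isCP_card_smul_sub

end Simulation

end BiComm

theorem mainTheorem2 {a₀ b₀ a₁ b₁ : Type*}
    [Fintype a₀] [DecidableEq a₀] [Nonempty a₀] [Fintype b₀] [DecidableEq b₀] [Nonempty b₀]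
    [Fintype a₁] [DecidableEq a₁] [Fintype b₁] [DecidableEq b₁]
    (N : BiComm.QMap (a₀ × b₀) (a₁ × b₁)) (hN : BiComm.IsChannel N) :
    (∀ ε : ℝ≥0, BiComm.dMaxBiSmooth ε N ≤ BiComm.commCost ε N) ∧
      BiComm.dMaxBi N ≤ BiComm.commCost 0 N := by
  refine ⟨fun ε => le_iInf₂ fun m hm => ?_, le_iInf₂ fun m hm => ?_⟩
  · obtain ⟨M, hM, hle⟩ := BiComm.exists_dMaxBi_le_of_simError_le hm.1 hm.2
    exact iInf₂_le_of_le M hM hle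
  · obtain ⟨M, hM, hle⟩ := BiComm.exists_dMaxBi_le_of_simError_le hm.1 hm.2
    have h0 : BiComm.diamondNorm (M - N) = 0 := by simpa using hM.2
    rwa [← sub_eq_zero.1 (BiComm.eq_zero_of_diamondNorm_eq_zero h0)]
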